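/- Let $m,n,\ell$ be non-negative integers with $\ell>2n$ and let $r\in\{2,3,4,\dots\}\cup\{\infty\}$. Let $X$ be an $n$-dimensional $C^r$ manifold (Hausdorff, without boundary, with a countable basis), let $V\subseteq\mathbb{R}^m$ be open, let $f:X\to V$ be an injective immersion of class $C^r$ (that is, $f$ is injective and of class $C^r$, and its differential $df_x$ is injective for every $x\in X$), and let $g:V\to\mathbb{R}^\ell$ be a mapping of class $C^r$. Let $\mathcal{L}(\mathbb{R}^m,\mathbb{R}^\ell)$ be the space of all linear mappings $\mathbb{R}^m\to\mathbb{R}^\ell$, regarded as the Euclidean space $\mathbb{R}^{m\ell}$ through the matrix entries, and set $$\Sigma=\{\pi\in\mathcal{L}(\mathbb{R}^m,\mathbb{R}^\ell) : (g+\pi)\circ f:X\to\mathbb{R}^\ell \text{ is not an injective immersion of class } C^r\}.$$ Then for every real number $s$ satisfying $$s>m\ell+2n-\ell,$$ the set $\Sigma$ has $s$-dimensional Hausdorff measure zero in $\mathcal{L}(\mathbb{R}^m,\mathbb{R}^\ell)$. -/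

import Mathlib

open scoped Manifold MeasureTheory

/-- `f : X → ℝᵐ` is an immersion of class `C^r` (used for `r ≥ 1`) of the `n`-dimensional manifold
`X`: it is of class `C^r` and its differential `df_x : T_x X → ℝᵐ` is injective at every point. -/
def IsCrImmersion (n : ℕ) (r : ℕ∞) {m : ℕ} {X : Type*} [TopologicalSpace X]
    [ChartedSpace (EuclideanSpace ℝ (Fin n)) X] (f : X → EuclideanSpace ℝ (Fin m)) : Prop :=
  ContMDiff (𝓡 n) (𝓡 m) r f ∧ ∀ x : X, Function.Injective (mfderiv (𝓡 n) (𝓡 m) f x)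

/-- An injective immersion of class `C^r`. -/
def IsCrInjectiveImmersion (n : ℕ) (r : ℕ∞) {m : ℕ} {X : Type*} [TopologicalSpace X]
    [ChartedSpace (EuclideanSpace ℝ (Fin n)) X] (f : X → EuclideanSpace ℝ (Fin m)) : Prop :=
  Function.Injective f ∧ IsCrImmersion n r f

/-- The identification of the space of linear maps `ℝᵐ → ℝˡ` with the Euclidean space of
dimension `m * l`: a linear map is sent to the family of its matrix entries. -/
noncomputable def linearMapCoords {m l : ℕ}
    (π : EuclideanSpace ℝ (Fin m) →ₗ[ℝ] EuclideanSpace ℝ (Fin l)) :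
    EuclideanSpace ℝ (Fin l × Fin m) :=
  WithLp.toLp 2 fun p => π (EuclideanSpace.single p.2 1) p.1

/-- A set of linear maps `ℝᵐ → ℝˡ` has `s`-dimensional Hausdorff measure zero, the space of linear
maps being regarded as a Euclidean space through the matrix entries. -/
def HasHausdorffMeasureZero {m l : ℕ} (s : ℝ)
    (S : Set (EuclideanSpace ℝ (Fin m) →ₗ[ℝ] EuclideanSpace ℝ (Fin l))) : Prop :=
  μH[s] (linearMapCoords '' S) = 0

open Set Topology

/-! A map `π` is bad only if `π (f x - f y) = g (f y) - g (f x)` for some `x ≠ y`, or `π (df v) =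
-dg (df v)` for some tangent vector `v ≠ 0`. Both have the form `π a = b` with `a ≠ 0`, where in
charts `a` and `b` are `C^1` functions of `2n` real parameters. Where `a i ≠ 0`, the equation gives
column `i` of `π` in terms of the other columns (`solveColumn`). So the bad maps lie in countably
many `C^1` images of sets of dimension at most `2n + l(m-1) = ml + 2n - l < s`, and such images do
not exceed that dimension. -/

/-- The image of a subset of a finite-dimensional space under a map that is `C^1` at each point of
this subset has Hausdorff dimension at most the dimension of the space. -/
theorem dimH_image_le_finrank_of_contDiffAt {E F : Type*} [NormedAddCommGroup E] [NormedSpace ℝ E]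
    [FiniteDimensional ℝ E] [NormedAddCommGroup F] [NormedSpace ℝ F] {φ : E → F} {S : Set E}
    (hφ : ∀ p ∈ S, ContDiffAt ℝ 1 φ p) : dimH (φ '' S) ≤ Module.finrank ℝ E := by
  have : SecondCountableTopology E := secondCountable_of_proper
  rw [← Real.dimH_univ_eq_finrank E]
  refine (dimH_image_le_of_locally_lipschitzOn fun p hp => ?_).trans (dimH_mono (subset_univ S))
  obtain ⟨C, t, ht, hC⟩ := (hφ p hp).exists_lipschitzOnWith
  exact ⟨C, t, mem_nhdsWithin_of_mem_nhds ht, hC⟩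

theorem linearMap_apply_eq_sum {m l : ℕ}
    (π : EuclideanSpace ℝ (Fin m) →ₗ[ℝ] EuclideanSpace ℝ (Fin l)) (a : EuclideanSpace ℝ (Fin m))
    (k : Fin l) : π a k = ∑ j, a j * linearMapCoords π (k, j) := by
  conv_lhs => rw [← (EuclideanSpace.basisFun (Fin m) ℝ).sum_repr a]
  simp [linearMapCoords]

/-- The matrix whose columns other than the `i`-th are given by `A`, and whose `i`-th column is
such that the matrix maps `a` to `b` (when `a i ≠ 0`). -/
noncomputable def solveColumn {m l : ℕ} (i : Fin m) (a : EuclideanSpace ℝ (Fin m))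
    (b : EuclideanSpace ℝ (Fin l)) (A : Fin l × {j : Fin m // j ≠ i} → ℝ) :
    EuclideanSpace ℝ (Fin l × Fin m) :=
  WithLp.toLp 2 fun q =>
    if h : q.2 ≠ i then A (q.1, ⟨q.2, h⟩)
    else (b q.1 - ∑ j : {j : Fin m // j ≠ i}, a j * A (q.1, j)) / a i

/-- Row `k` of `π a = b` is affine in the entry `(k, i)`, with leading coefficient `a i`. -/
theorem solveColumn_linearMapCoords {m l : ℕ} {i : Fin m} {a : EuclideanSpace ℝ (Fin m)}
    (ha : a i ≠ 0) (π : EuclideanSpace ℝ (Fin m) →ₗ[ℝ] EuclideanSpace ℝ (Fin l)) :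
    solveColumn i a (π a) (fun q => linearMapCoords π (q.1, q.2)) = linearMapCoords π := by
  ext ⟨k, j⟩
  by_cases h : j = i
  · subst h
    have hsum := Fintype.sum_eq_add_sum_subtype_ne (fun j' => a j' * linearMapCoords π (k, j')) j
    rw [← linearMap_apply_eq_sum] at hsum
    simp only [solveColumn, ne_eq, not_true_eq_false, dite_false, hsum]
    field_simp
    ring
  · simp [solveColumn, h]

theorem ContDiffAt.solveColumn {E : Type*} [NormedAddCommGroup E] [NormedSpace ℝ E] {m l : ℕ}
    {i : Fin m} {a : E → EuclideanSpace ℝ (Fin m)} {b : E → EuclideanSpace ℝ (Fin l)}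
    {A : E → Fin l × {j : Fin m // j ≠ i} → ℝ} {p : E} {k : WithTop ℕ∞}
    (ha : ContDiffAt ℝ k a p) (hb : ContDiffAt ℝ k b p) (hA : ContDiffAt ℝ k A p)
    (hi : a p i ≠ 0) : ContDiffAt ℝ k (fun q => solveColumn i (a q) (b q) (A q)) p := by
  rw [contDiffAt_euclidean] at ha hb
  rw [contDiffAt_pi] at hA
  refine contDiffAt_euclidean.2 fun ⟨c, j⟩ => ?_
  by_cases h : j = i
  · simp only [_root_.solveColumn, h, ne_eq, not_true_eq_false, dite_false]
    exact ((hb c).sub (ContDiffAt.sum fun j' _ => (ha j'.1).mul (hA (c, j')))).div (ha i) hi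
  · simpa only [_root_.solveColumn, h, ne_eq, not_false_eq_true, dite_true] using hA _

/-- Linear maps satisfying `π (a p) = b p` for some parameter `p` in a set on which `a` does not
vanish: each parameter imposes `l` independent conditions. -/
theorem dimH_linearMapCoords_image_le {E : Type*} [NormedAddCommGroup E] [NormedSpace ℝ E]
    [FiniteDimensional ℝ E] {m l : ℕ} {S : Set E} {a : E → EuclideanSpace ℝ (Fin m)}
    {b : E → EuclideanSpace ℝ (Fin l)} (ha : ∀ p ∈ S, ContDiffAt ℝ 1 a p)
    (hb : ∀ p ∈ S, ContDiffAt ℝ 1 b p) (ha0 : ∀ p ∈ S, a p ≠ 0) :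
    dimH (linearMapCoords '' {π : EuclideanSpace ℝ (Fin m) →ₗ[ℝ] EuclideanSpace ℝ (Fin l) |
      ∃ p ∈ S, π (a p) = b p}) ≤ (Module.finrank ℝ E + l * (m - 1) : ℕ) := by
  let Φ (i : Fin m) (q : E × (Fin l × {j : Fin m // j ≠ i} → ℝ)) :=
    solveColumn i (a q.1) (b q.1) q.2
  let T (i : Fin m) : Set (E × (Fin l × {j : Fin m // j ≠ i} → ℝ)) :=
    {q | q.1 ∈ S ∧ a q.1 i ≠ 0}
  refine (dimH_mono (t := ⋃ i, Φ i '' T i) ?_).trans ?_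
  · rintro _ ⟨π, ⟨p, hp, hπ⟩, rfl⟩
    obtain ⟨i, hi⟩ : ∃ i, a p i ≠ 0 := by
      by_contra! h
      exact ha0 p hp (by ext i; simpa using h i)
    refine mem_iUnion.2 ⟨i, (p, fun q => linearMapCoords π (q.1, q.2)), ⟨hp, hi⟩, ?_⟩
    simp only [Φ, ← hπ]
    exact solveColumn_linearMapCoords hi π
  · rw [dimH_iUnion]
    refine iSup_le fun i => (dimH_image_le_finrank_of_contDiffAt ?_).trans (le_of_eq ?_)
    · rintro ⟨p, A⟩ ⟨hp, hi⟩
      exact ContDiffAt.solveColumn (ContDiffAt.comp (p, A) (ha p hp) contDiffAt_fst)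
        (ContDiffAt.comp (p, A) (hb p hp) contDiffAt_fst) contDiffAt_snd hi
    · simp [Module.finrank_prod]

section Manifold

variable {n m l : ℕ} {r : ℕ∞} {X : Type*} [TopologicalSpace X]
    [ChartedSpace (EuclideanSpace ℝ (Fin n)) X] [IsManifold (𝓡 n) r X]

theorem ContMDiff.contDiffAt_comp_chartAt_symm {f : X → EuclideanSpace ℝ (Fin m)}
    (hf : ContMDiff (𝓡 n) (𝓡 m) r f) (c : X) {u : EuclideanSpace ℝ (Fin n)}
    (hu : u ∈ (chartAt (EuclideanSpace ℝ (Fin n)) c).target) :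
    ContDiffAt ℝ r (f ∘ (chartAt (EuclideanSpace ℝ (Fin n)) c).symm) u :=
  contMDiffAt_iff_contDiffAt.1 (hf.contMDiffAt.comp u
    ((contMDiffOn_chart_symm (I := 𝓡 n) (n := r) (x := c)).contMDiffAt
      ((chartAt (EuclideanSpace ℝ (Fin n)) c).open_target.mem_nhds hu)))

/-- Every value of the differential of `f` is a value of the differential of `f` read in a chart. -/
theorem exists_fderiv_comp_chartAt_symm_eq {f : X → EuclideanSpace ℝ (Fin m)}
    (hr : 1 ≤ r) (hf : ContMDiff (𝓡 n) (𝓡 m) r f) (c : X) {u : EuclideanSpace ℝ (Fin n)}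
    (hu : u ∈ (chartAt (EuclideanSpace ℝ (Fin n)) c).target)
    (v : TangentSpace (𝓡 n) ((chartAt (EuclideanSpace ℝ (Fin n)) c).symm u)) :
    ∃ w : EuclideanSpace ℝ (Fin n),
      fderiv ℝ (f ∘ (chartAt (EuclideanSpace ℝ (Fin n)) c).symm) u w =
        mfderiv (𝓡 n) (𝓡 m) f ((chartAt (EuclideanSpace ℝ (Fin n)) c).symm u) v := by
  have hr0 : (r : WithTop ℕ∞) ≠ 0 := by
    intro h
    have : r = 0 := by exact_mod_cast h
    simp [this] at hr
  have : IsManifold (𝓡 n) 1 X := IsManifold.of_le (n := r) (by exact_mod_cast hr)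
  have he := mdifferentiable_chart (I := 𝓡 n) c
  -- The inverse chart has surjective differential, so `v` lifts to a vector of the model space.
  obtain ⟨w, hw⟩ := he.symm.mfderiv_surjective hu v
  refine ⟨w, ?_⟩
  rw [← mfderiv_eq_fderiv,
    mfderiv_comp u (hf.mdifferentiable hr0 _) (he.mdifferentiableAt_symm hu), ← hw]
  rfl

/-- The linear maps `π` for which `(g + π) ∘ f` is not injective. -/
theorem dimH_not_injective_add_comp_le [SecondCountableTopology X] (hr : 1 ≤ r)
    {V : Set (EuclideanSpace ℝ (Fin m))} (hV : IsOpen V) {f : X → EuclideanSpace ℝ (Fin m)}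
    (hfV : ∀ x, f x ∈ V) (hf : ContMDiff (𝓡 n) (𝓡 m) r f) (hinj : Function.Injective f)
    {g : EuclideanSpace ℝ (Fin m) → EuclideanSpace ℝ (Fin l)} (hg : ContDiffOn ℝ r g V) :
    dimH (linearMapCoords '' {π : EuclideanSpace ℝ (Fin m) →ₗ[ℝ] EuclideanSpace ℝ (Fin l) |
      ¬ Function.Injective fun x => g (f x) + π (f x)}) ≤ (2 * n + l * (m - 1) : ℕ) := by
  have hr' : (1 : WithTop ℕ∞) ≤ r := by exact_mod_cast hr
  obtain ⟨s, hs, hsU⟩ := TopologicalSpace.countable_cover_nhds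
    (chart_source_mem_nhds (M := X) (EuclideanSpace ℝ (Fin n)))
  have := hs.to_subtype
  let e (c : X) := chartAt (EuclideanSpace ℝ (Fin n)) c
  let F (c : X) := f ∘ (e c).symm
  -- Two charts, since the colliding points may be far apart.
  let S (q : s × s) : Set (EuclideanSpace ℝ (Fin n) × EuclideanSpace ℝ (Fin n)) :=
    {p | p.1 ∈ (e q.1).target ∧ p.2 ∈ (e q.2).target ∧ F q.1 p.1 - F q.2 p.2 ≠ 0}
  have hF (c : X) {u} (hu : u ∈ (e c).target) : ContDiffAt ℝ 1 (F c) u :=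
    (hf.contDiffAt_comp_chartAt_symm c hu).of_le hr'
  have hgF (c : X) {u} (hu : u ∈ (e c).target) : ContDiffAt ℝ 1 (g ∘ F c) u :=
    ((hg.contDiffAt (hV.mem_nhds (hfV _))).of_le hr').comp u (hF c hu)
  refine (dimH_mono (t := ⋃ q, linearMapCoords '' {π | ∃ p ∈ S q,
    π (F q.1 p.1 - F q.2 p.2) = (g ∘ F q.2) p.2 - (g ∘ F q.1) p.1}) ?_).trans ?_
  · rintro _ ⟨π, hπ, rfl⟩
    simp only [Function.Injective, mem_ofPred_eq, not_forall] at hπ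
    obtain ⟨x, y, hxy, hne⟩ := hπ
    obtain ⟨c, hc, hxc⟩ := mem_iUnion₂.1 (hsU ▸ mem_univ x)
    obtain ⟨d, hd, hyd⟩ := mem_iUnion₂.1 (hsU ▸ mem_univ y)
    have hx : F c (e c x) = f x := congrArg f ((e c).left_inv hxc)
    have hy : F d (e d y) = f y := congrArg f ((e d).left_inv hyd)
    refine mem_iUnion.2 ⟨(⟨c, hc⟩, ⟨d, hd⟩), mem_image_of_mem _ ⟨(e c x, e d y),
      ⟨(e c).map_source hxc, (e d).map_source hyd, ?_⟩, ?_⟩⟩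
    · simpa only [hx, hy, sub_ne_zero] using hinj.ne hne
    · simp only [Function.comp_apply, hx, hy, map_sub]
      rw [sub_eq_sub_iff_add_eq_add, add_comm, hxy, add_comm]
  · rw [dimH_iUnion]
    refine iSup_le fun q => (dimH_linearMapCoords_image_le ?_ ?_ fun p hp => hp.2.2).trans ?_
    · rintro p ⟨h1, h2, -⟩
      exact ((hF _ h1).comp p contDiffAt_fst).sub ((hF _ h2).comp p contDiffAt_snd)
    · rintro p ⟨h1, h2, -⟩
      exact ((hgF _ h2).comp p contDiffAt_snd).sub ((hgF _ h1).comp p contDiffAt_fst)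
    · simp [Module.finrank_prod, two_mul]

/-- The linear maps `π` for which the differential of `(g + π) ∘ f` is not everywhere injective. -/
theorem dimH_not_injective_mfderiv_add_comp_le [SecondCountableTopology X] (hr : 2 ≤ r)
    {V : Set (EuclideanSpace ℝ (Fin m))} (hV : IsOpen V) {f : X → EuclideanSpace ℝ (Fin m)}
    (hfV : ∀ x, f x ∈ V) (hf : IsCrImmersion n r f)
    {g : EuclideanSpace ℝ (Fin m) → EuclideanSpace ℝ (Fin l)} (hg : ContDiffOn ℝ r g V) :
    dimH (linearMapCoords '' {π : EuclideanSpace ℝ (Fin m) →ₗ[ℝ] EuclideanSpace ℝ (Fin l) |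
      ¬ ∀ x, Function.Injective (mfderiv (𝓡 n) (𝓡 l) (fun x => g (f x) + π (f x)) x)}) ≤
      (2 * n + l * (m - 1) : ℕ) := by
  have hr1 : 1 ≤ r := one_le_two.trans hr
  have hr1' : (1 : WithTop ℕ∞) ≤ r := by exact_mod_cast hr1
  -- Here `r ≥ 2` is spent: the differentials entering `a` and `b` must themselves be `C^1`.
  have hr2 : (1 + 1 : WithTop ℕ∞) ≤ r := 
    WithTop.coe_le_coe.2 (one_add_one_eq_two.trans_le hr)
  have hr0 : (r : WithTop ℕ∞) ≠ 0 := (one_pos.trans_le hr1').ne'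
  obtain ⟨s, hs, hsU⟩ := TopologicalSpace.countable_cover_nhds
    (chart_source_mem_nhds (M := X) (EuclideanSpace ℝ (Fin n)))
  have := hs.to_subtype
  let e (c : X) := chartAt (EuclideanSpace ℝ (Fin n)) c
  let F (c : X) := f ∘ (e c).symm
  -- Directions are not normalised: this costs one parameter, but `2n` in all still meets the bound.
  let S (c : s) : Set (EuclideanSpace ℝ (Fin n) × EuclideanSpace ℝ (Fin n)) :=
    {p | p.1 ∈ (e c).target ∧ fderiv ℝ (F c) p.1 p.2 ≠ 0}
  have hF (c : X) {u} (hu : u ∈ (e c).target) : ContDiffAt ℝ r (F c) u :=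
    hf.1.contDiffAt_comp_chartAt_symm c hu
  have hgV (x : X) : ContDiffAt ℝ r g (f x) := hg.contDiffAt (hV.mem_nhds (hfV x))
  have hF' {c : s} {p} (hp : p ∈ S c) :
      ContDiffAt ℝ 1 (fun p : EuclideanSpace ℝ (Fin n) × EuclideanSpace ℝ (Fin n) =>
        fderiv ℝ (F c) p.1 p.2) p :=
    ContDiffAt.clm_apply (ContDiffAt.comp p ((hF c hp.1).fderiv_right hr2) contDiffAt_fst)
      contDiffAt_snd
  refine (dimH_mono (t := ⋃ c : s, linearMapCoords '' {π | ∃ p ∈ S c,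
    π (fderiv ℝ (F c) p.1 p.2) =
      -(fderiv ℝ g (F c p.1) (fderiv ℝ (F c) p.1 p.2))}) ?_).trans ?_
  · rintro _ ⟨π, hπ, rfl⟩
    obtain ⟨x, hx⟩ := not_forall.1 hπ
    obtain ⟨c, hc, hxc⟩ := mem_iUnion₂.1 (hsU ▸ mem_univ x)
    obtain ⟨u, hu, rfl⟩ : ∃ u ∈ (e c).target, (e c).symm u = x :=
      ⟨e c x, (e c).map_source hxc, (e c).left_inv hxc⟩
    have hgπ : HasFDerivAt (fun y => g y + π y)
        (fderiv ℝ g (F c u) + LinearMap.toContinuousLinearMap π) (F c u) :=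
      ((hgV ((e c).symm u)).differentiableAt hr0).hasFDerivAt.add
        (LinearMap.toContinuousLinearMap π).hasFDerivAt
    have hcomp := HasMFDerivAt.comp ((e c).symm u) hgπ.hasMFDerivAt
      (hf.1.mdifferentiable hr0 ((e c).symm u)).hasMFDerivAt
    replace hx : ¬ Function.Injective ((fderiv ℝ g (F c u) + LinearMap.toContinuousLinearMap π).comp
        (mfderiv (𝓡 n) (𝓡 m) f ((e c).symm u))) := hcomp.mfderiv ▸ hx
    rw [injective_iff_map_eq_zero] at hx
    push Not at hx
    obtain ⟨v, hv, hv0⟩ := hx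
    obtain ⟨w, hw⟩ := exists_fderiv_comp_chartAt_symm_eq hr1 hf.1 c hu v
    refine mem_iUnion.2 ⟨⟨c, hc⟩, mem_image_of_mem _ ⟨(u, w), ⟨hu, ?_⟩, ?_⟩⟩
    · exact fun h => hv0 (hf.2 _ ((hw.symm.trans h).trans (map_zero _).symm))
    · refine eq_neg_of_add_eq_zero_right ?_
      exact (congrArg (fun z => fderiv ℝ g (F c u) z + π z) hw).trans hv
  · rw [dimH_iUnion]
    refine iSup_le fun c => (dimH_linearMapCoords_image_le (fun p hp => hF' hp) ?_
      fun p hp => hp.2).trans ?_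
    · intro p hp
      have hgF : ContDiffAt ℝ 1 (fderiv ℝ g ∘ F c) p.1 :=
        ((hgV _).fderiv_right hr2).comp p.1 ((hF c hp.1).of_le hr1')
      exact ((hgF.comp p contDiffAt_fst).clm_apply (hF' hp)).neg
    · simp [Module.finrank_prod, two_mul]

end Manifold

theorem theorem5p13 (n m l : ℕ) (hl : 2 * n < l) (r : ℕ∞) (hr : 2 ≤ r)
    {X : Type*} [TopologicalSpace X] [T2Space X] [SecondCountableTopology X]
    [ChartedSpace (EuclideanSpace ℝ (Fin n)) X] [IsManifold (𝓡 n) r X]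
    (V : Set (EuclideanSpace ℝ (Fin m))) (hV : IsOpen V)
    (f : X → EuclideanSpace ℝ (Fin m)) (hfV : ∀ x, f x ∈ V)
    (hf : IsCrInjectiveImmersion n r f)
    (g : EuclideanSpace ℝ (Fin m) → EuclideanSpace ℝ (Fin l)) (hg : ContDiffOn ℝ r g V)
    (s : ℝ) (hs : (m : ℝ) * l + 2 * n - l < s) :
    HasHausdorffMeasureZero s
      {π : EuclideanSpace ℝ (Fin m) →ₗ[ℝ] EuclideanSpace ℝ (Fin l) |
        ¬ IsCrInjectiveImmersion n r (fun x : X => g (f x) + π (f x))} := by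
  have hsmooth (π : EuclideanSpace ℝ (Fin m) →ₗ[ℝ] EuclideanSpace ℝ (Fin l)) :
      ContMDiff (𝓡 n) (𝓡 l) r fun x : X => g (f x) + π (f x) := by
    intro x
    have hgπ : ContDiffAt ℝ r (fun y => g y + π y) (f x) :=
      (hg.contDiffAt (hV.mem_nhds (hfV x))).add
        (LinearMap.toContinuousLinearMap π).contDiff.contDiffAt
    exact hgπ.contMDiffAt.comp x (hf.2.1 x)
  -- For `m = 0` the truncated `m - 1` breaks `l(m-1) = ml - l`, and `s` may be negative. But then
  -- `X` has at most one point and no `π` is bad.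
  rcases m.eq_zero_or_pos with rfl | hm
  · have hsub : Subsingleton X := hf.1.subsingleton
    suffices h : {π : EuclideanSpace ℝ (Fin 0) →ₗ[ℝ] EuclideanSpace ℝ (Fin l) |
        ¬ IsCrInjectiveImmersion n r (fun x : X => g (f x) + π (f x))} = ∅ by
      simp [HasHausdorffMeasureZero, h]
    refine eq_empty_of_forall_notMem fun π hπ => hπ ⟨Function.injective_of_subsingleton _,
      hsmooth π, fun x v w _ => ?_⟩
    exact hf.2.2 x (Subsingleton.elim (α := EuclideanSpace ℝ (Fin 0)) _ _)
  have hdim : dimH (linearMapCoords ''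
      {π : EuclideanSpace ℝ (Fin m) →ₗ[ℝ] EuclideanSpace ℝ (Fin l) |
        ¬ IsCrInjectiveImmersion n r (fun x : X => g (f x) + π (f x))}) ≤
      (2 * n + l * (m - 1) : ℕ) := by
    have hr1 : 1 ≤ r := one_le_two.trans hr
    refine le_trans (dimH_mono ?_) ((dimH_union _ _).trans_le (max_le
      (dimH_not_injective_add_comp_le hr1 hV hfV hf.2.1 hf.1 hg)
      (dimH_not_injective_mfderiv_add_comp_le hr hV hfV hf.2 hg)))
    rw [← image_union]
    refine image_mono fun π hπ => ?_
    by_contra h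
    simp only [mem_union, mem_ofPred_eq, not_or, not_not] at h
    exact hπ ⟨h.1, hsmooth π, h.2⟩
  have hs' : ((2 * n + l * (m - 1) : ℕ) : ℝ) < s := by
    rw [Nat.cast_add, Nat.cast_mul, Nat.cast_mul, Nat.cast_sub hm]
    push_cast
    linarith
  lift s to NNReal using (Nat.cast_nonneg _).trans hs'.le
  refine hausdorffMeasure_of_dimH_lt (hdim.trans_lt ?_)
  exact_mod_cast hs'
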